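/- **Setting.** Fix countably infinite supplies of variables, constants and predicates. An *atom* is $p(t_1,\dots,t_k)$ with $p$ a predicate of arity $k$ and each $t_i$ a variable or a constant; a *fact* is an atom without variables. An *existential rule* $R = B \to H$ is a formula $\forall \vec x\,\forall \vec y\,(B[\vec x,\vec y] \to \exists \vec z\, H[\vec x,\vec z])$ where $B$ (body) and $H$ (head) are nonempty conjunctions of atoms, viewed as sets of atoms; the variables $\vec z$, which occur only in $H$, are called *existential*. A *knowledge base* (KB) $\mathcal K=(\mathcal F,\mathcal R)$ consists of a finite set $\mathcal F$ of facts and a finite set $\mathcal R$ of rules. An *atomic CQ* $Q$ is an existentially closed atom. *Atomic CQ entailment* over a class of KBs is the problem of deciding, given a KB $\mathcal K$ of the class and an atomic CQ $Q$, whether $\mathcal K \models Q$ in standard first-order logic. A partition $P$ of a set of terms is *admissible* if no class of $P$ contains two constants; a substitution obtained from $P$ maps every term of a class to one chosen element of that class, which is the constant of the class if there is one. A *piece-unifier* of a set of atoms $Q$ with a rule $R = B\to H$ (whose variables have been renamed so as not to occur in $Q$) is a triple $(Q',H',P)$ where $\emptyset \ne Q'\subseteq Q$, $H'\subseteq H$,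 and $P$ is an admissible partition of the terms of $Q'\cup H'$ such that (1) $\sigma(H')=\sigma(Q')$ for any substitution $\sigma$ obtained from $P$, and (2) if a class of $P$ contains an existential variable of $R$, then all other terms of the class are variables of $Q'$ that do not occur in $Q\setminus Q'$. A rule $R_2$ *depends on* a rule $R_1$ if there is a piece-unifier of the body of $R_2$ with $R_1$. A set $\mathcal R$ of rules is *aGRD* if the directed graph on $\mathcal R$ with an edge from $R_1$ to $R_2$ whenever $R_2$ depends on $R_1$ has no directed cycle (a loop counts as a cycle). A *transitivity rule* is a rule $p(x,y)\wedge p(y,z)\to p(x,z)$ with $x,y,z$ distinct variables. An *aGRD+trans* KB is a KB whose set of rules is the union of an aGRD set and a set of transitivity rules. **Theorem.** Atomic CQ entailment over aGRD+trans KBs is undecidable. It remains undecidable over the KBs whose set of rules is the union of an aGRD set and a single transitivity rule. Here undecidable means that no algorithm halts with the correct answer on every pair $(\mathcal K,Q)$ with $\mathcal K$ in the class, even if nothing is required of it on other inputs. -/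

import Mathlib

namespace ExRules

/-! ### Syntax

Variables are taken from a type `V`, constants are natural numbers.  A predicate is a pair of a name
(a natural number) and an arity; the arity of the predicate of an atom is the number of its arguments,
so that atoms with the same name and different arities have different predicates.
Finite sets of atoms, facts and rules are presented by lists. -/

/-- A term is a variable (`Sum.inl`) or a constant (`Sum.inr`). -/
abbrev Term (V : Type) : Type := V ⊕ ℕ

/-- An atom `p(t₁, …, tₖ)`: a predicate name and a list of terms. -/
abbrev Atom (V : Type) : Type := ℕ × List (Term V)

/-- A fact `p(c₁, …, cₖ)`, that is, an atom without variables. -/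
abbrev Fact : Type := ℕ × List ℕ

/-- An existential rule `B → H`, as the pair of its body `B` and its head `H`. -/
abbrev Rule (V : Type) : Type := List (Atom V) × List (Atom V)

/-- A knowledge base: a fact base and a finite set of rules. -/
abbrev KB : Type := List Fact × List (Rule ℕ)

section
variable {V W : Type}

def Rule.body (r : Rule V) : List (Atom V) := r.1

def Rule.head (r : Rule V) : List (Atom V) := r.2

def KB.facts (K : KB) : List Fact := K.1

def KB.rules (K : KB) : List (Rule ℕ) := K.2

/-- The terms that occur in a set of atoms. -/
def termsOf (A : Set (Atom V)) : Set (Term V) := {t | ∃ a ∈ A, t ∈ a.2}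

/-- The variables that occur in a set of atoms. -/
def varsOf (A : Set (Atom V)) : Set V := {x | Sum.inl x ∈ termsOf A}

def bodySet (r : Rule V) : Set (Atom V) := {a | a ∈ Rule.body r}

def headSet (r : Rule V) : Set (Atom V) := {a | a ∈ Rule.head r}

/-- The existential variables of a rule: those that occur only in its head. -/
def existVars (r : Rule V) : Set V := varsOf (headSet r) \ varsOf (bodySet r)

/-- The result of replacing every term of an atom by its image under `σ`. -/
def Atom.map (σ : Term V → Term W) (a : Atom V) : Atom W := (a.1, a.2.map σ)

/-- The renaming of the variables of a rule along `f`. -/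
def Rule.rename (f : V → W) (r : Rule V) : Rule W :=
  ((Rule.body r).map (Atom.map (Sum.map f id)), (Rule.head r).map (Atom.map (Sum.map f id)))

/-- The body and the head of a rule are nonempty conjunctions. -/
def Rule.Proper (r : Rule V) : Prop := Rule.body r ≠ [] ∧ Rule.head r ≠ []

end

/-! ### First-order semantics -/

/-- A first-order interpretation with domain `D` (nonempty, since there are constants). -/
structure Interp (D : Type) where
  const : ℕ → D
  rel : ℕ → List D → Prop

namespace Interp
variable {D V : Type}

/-- The value of a term under an assignment of the variables. -/
def eval (I : Interp D) (v : V → D) (t : Term V) : D := Sum.elim v I.const t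

def SatAtom (I : Interp D) (v : V → D) (a : Atom V) : Prop := I.rel a.1 (a.2.map (I.eval v))

def SatFact (I : Interp D) (f : Fact) : Prop := I.rel f.1 (f.2.map I.const)

/-- `∀ x y, (B → ∃ z, H)`, where `z` are the variables that do not occur in `B`. -/
def SatRule (I : Interp D) (r : Rule V) : Prop :=
  ∀ v : V → D, (∀ a ∈ Rule.body r, I.SatAtom v a) →
    ∃ w : V → D, (∀ x ∈ varsOf (bodySet r), w x = v x) ∧ ∀ a ∈ Rule.head r, I.SatAtom w a

/-- The interpretation satisfies the atomic Boolean query `q`, all of whose variables are read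
existentially. -/
def SatQuery (I : Interp D) (q : Atom V) : Prop := ∃ v : V → D, I.SatAtom v q

/-- The interpretation is a model of the knowledge base. -/
def IsModel (I : Interp D) (K : KB) : Prop :=
  (∀ f ∈ KB.facts K, I.SatFact f) ∧ ∀ r ∈ KB.rules K, I.SatRule r

end Interp

/-- Logical entailment of an atomic conjunctive query from a knowledge base. -/
def Entails (K : KB) (q : Atom ℕ) : Prop :=
  ∀ (D : Type) (I : Interp D), I.IsModel K → I.SatQuery q

/-! ### Piece-unifiers and the graph of rule dependencies -/

section
variable {V : Type}

/-- A partition is admissible if no class contains two constants. -/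
def Admissible {T : Set (Term V)} (P : Partition T) : Prop :=
  ∀ C ∈ P, ∀ c d : ℕ, Sum.inr c ∈ C → Sum.inr d ∈ C → c = d

/-- `σ` selects an element in each class of `P`, with priority given to constants. -/
def IsSubstitutionOf {T : Set (Term V)} (P : Partition T) (σ : Term V → Term V) : Prop :=
  P.IsRepFun σ ∧ ∀ C ∈ P, ∀ c : ℕ, Sum.inr c ∈ C → ∀ t ∈ C, σ t = Sum.inr c

/-- `(Q', H', P)` is a piece-unifier of the conjunctive query `Q` (a set of atoms) with the rule `r`,
whose variables are supposed not to occur in `Q`. -/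
structure IsPieceUnifier (Q : Set (Atom V)) (r : Rule V) (Q' H' : Set (Atom V))
    (P : Partition (termsOf (Q' ∪ H'))) : Prop where
  nonempty : Q'.Nonempty
  subset_query : Q' ⊆ Q
  subset_head : H' ⊆ headSet r
  admissible : Admissible P
  unifies : ∀ σ, IsSubstitutionOf P σ → Atom.map σ '' H' = Atom.map σ '' Q'
  existential : ∀ C ∈ P, ∀ z ∈ existVars r, Sum.inl z ∈ C → ∀ t ∈ C, t ≠ Sum.inl z →
    ∃ x ∈ varsOf Q', t = Sum.inl x ∧ x ∉ varsOf (Q \ Q')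

/-- The rule `r₂` depends on the rule `r₁`: there is a piece-unifier of the body of `r₂` with (the head
of) `r₁`, after the variables of the two rules have been renamed apart. -/
def DependsOn (r₂ r₁ : Rule V) : Prop :=
  ∃ (Q' H' : Set (Atom (V ⊕ V))) (P : Partition (termsOf (Q' ∪ H'))),
    IsPieceUnifier (bodySet (Rule.rename Sum.inl r₂)) (Rule.rename Sum.inr r₁) Q' H' P

/-- The edges of the graph of rule dependencies of a set of rules, from `r₁` to `r₂`. -/
def GRD (R : Set (Rule V)) (r₁ r₂ : Rule V) : Prop := r₁ ∈ R ∧ r₂ ∈ R ∧ DependsOn r₂ r₁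

/-- The graph of rule dependencies has no directed cycle (a loop is a cycle). -/
def IsAGRD (R : Set (Rule V)) : Prop := ∀ r, ¬ Relation.TransGen (GRD R) r r

/-- A rule of the form `p(x, y) ∧ p(y, z) → p(x, z)`, with three distinct variables. -/
def IsTransitivityRule (r : Rule V) : Prop :=
  ∃ (p : ℕ) (x y z : V), x ≠ y ∧ y ≠ z ∧ x ≠ z ∧
    bodySet r = {(p, [Sum.inl x, Sum.inl y]), (p, [Sum.inl y, Sum.inl z])} ∧
    headSet r = {(p, [Sum.inl x, Sum.inl z])}

end

/-- The set of rules of a knowledge base. -/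
def KB.ruleSet (K : KB) : Set (Rule ℕ) := {r | r ∈ KB.rules K}

/-- The rules of `K` form an aGRD set of rules to which transitivity rules are added. -/
def IsAGRDTrans (K : KB) : Prop :=
  (∀ r ∈ KB.rules K, Rule.Proper r) ∧
    ∃ Ra Rt : Set (Rule ℕ), IsAGRD Ra ∧ (∀ r ∈ Rt, IsTransitivityRule r) ∧
      KB.ruleSet K = Ra ∪ Rt

/-- The rules of `K` form an aGRD set of rules to which one transitivity rule is added. -/
def IsAGRDSingleTrans (K : KB) : Prop :=
  (∀ r ∈ KB.rules K, Rule.Proper r) ∧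
    ∃ (Ra : Set (Rule ℕ)) (t : Rule ℕ), IsAGRD Ra ∧ IsTransitivityRule t ∧
      KB.ruleSet K = Ra ∪ {t}

/-! ### Decidability -/

/-- The problem `P`, restricted to the instances in the class `C`, is decidable: some algorithm halts
with the right answer on every instance in `C` (nothing is asked of it on the other inputs). -/
def DecidableOn {α : Type} [Primcodable α] (C P : α → Prop) : Prop :=
  ∃ f : α →. Bool, Partrec f ∧ ∀ a, C a → ∃ b ∈ f a, (b = true ↔ P a)

end ExRules

/-!
A rule `r` is split into a rule that creates a trigger for each match of the body of `r`, and a rule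
that fires the head of `r` from a trigger linked to itself. The new trigger is only linked to a second
new element and back, so that transitivity of links, and nothing else, links it to itself. A
piece-unifier of the body of a firing rule with a triggering rule maps the trigger to an existential
variable, so it has to unify the self-link as well; but that identifies the two new elements, which
are distinct existential variables. Hence the triggering and firing rules form an aGRD set. With a
single transitivity rule for links they entail the same atomic queries over the original predicates
as the original rules do.

Entailment of atomic queries from arbitrary existential rules is undecidable. One rule extends a
successor chain indefinitely, and Datalog rules over this chain compute the graphs of the partial
recursive functions. Starting from a universal code, the rules and the query are fixed, and only the
facts depend on the input.
-/

namespace ExRules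

/-! ### Unification without renaming -/

section
variable {V W : Type} {f : V → W} {r r₁ r₂ : Rule V}

theorem Atom.map_injective {σ : Term V → Term W} (hσ : Function.Injective σ) :
    Function.Injective (Atom.map σ) :=
  Function.injective_id.prodMap hσ.list_map

theorem termsOf_image_map (σ : Term V → Term W) (A : Set (Atom V)) :
    termsOf (Atom.map σ '' A) = σ '' termsOf A := by
  ext t
  constructor
  · rintro ⟨_, ⟨a, ha, rfl⟩, ht⟩
    obtain ⟨s, hs, rfl⟩ := List.mem_map.1 ht
    exact ⟨s, ⟨a, ha, hs⟩, rfl⟩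
  · rintro ⟨s, ⟨a, ha, hs⟩, rfl⟩
    exact ⟨_, ⟨a, ha, rfl⟩, List.mem_map_of_mem hs⟩

theorem varsOf_image_map (f : V → W) (A : Set (Atom V)) :
    varsOf (Atom.map (Sum.map f id) '' A) = f '' varsOf A := by
  ext x
  simp [varsOf, termsOf_image_map]

theorem bodySet_rename (f : V → W) (r : Rule V) :
    bodySet (r.rename f) = Atom.map (Sum.map f id) '' bodySet r := by
  ext a
  simp [bodySet, Rule.rename, Rule.body]

theorem headSet_rename (f : V → W) (r : Rule V) :
    headSet (r.rename f) = Atom.map (Sum.map f id) '' headSet r := by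
  ext a
  simp [headSet, Rule.rename, Rule.head]

theorem existVars_rename (hf : Function.Injective f) :
    existVars (r.rename f) = f '' existVars r := by
  rw [existVars, headSet_rename, bodySet_rename, varsOf_image_map, varsOf_image_map,
    ← Set.image_sdiff hf, existVars]

theorem Admissible.exists_isSubstitutionOf {T : Set (Term V)} {P : Partition T}
    (h : Admissible P) : ∃ σ, IsSubstitutionOf P σ := by
  obtain ⟨σ, hσ, hid⟩ := Partition.IsRepFun.exists_extend_partial' P (t := Set.range Sum.inr) (by
    rintro _ _ ⟨c, rfl⟩ ⟨d, rfl⟩ ⟨C, hC, hc, hd⟩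
    rw [h C hC c d hc hd])
  refine ⟨σ, hσ, fun C hC c hc t ht => ?_⟩
  rw [hσ.apply_eq_apply ⟨C, hC, ht, hc⟩]
  exact hid ⟨c, rfl⟩

theorem IsPieceUnifier.exists_eq_inl_of_apply_eq {Q Q' H' : Set (Atom V)}
    {P : Partition (termsOf (Q' ∪ H'))} (hP : IsPieceUnifier Q r Q' H' P) {σ : Term V → Term V}
    (hσ : IsSubstitutionOf P σ) {z : V} (hz : z ∈ existVars r) {t : Term V}
    (ht : t ∈ termsOf (Q' ∪ H')) (hne : t ≠ Sum.inl z) (h : σ t = σ (Sum.inl z)) :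
    ∃ x ∈ varsOf Q', t = Sum.inl x ∧ x ∉ varsOf (Q \ Q') := by
  obtain ⟨C, hC, htC, hzC⟩ := (hσ.1.apply_eq_apply_iff_rel ht).1 h
  exact hP.existential C hC z hz hzC t htC hne

/-- A piece-unifier of the body of `r₂` with `r₁` in which each of the two rules has its own
substitution, so that their variables need not be renamed apart; the atoms of `Q'` are unified with
atoms of `H'`. -/
structure IsUnification (r₂ r₁ : Rule V) (Q' H' : Set (Atom V)) (σ₂ σ₁ : Term V → Term W) :
    Prop where
  nonempty : Q'.Nonempty
  subset_body : Q' ⊆ bodySet r₂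
  subset_head : H' ⊆ headSet r₁
  unifies : ∀ a ∈ Q', ∃ b ∈ H', Atom.map σ₁ b = Atom.map σ₂ a
  eq_of_mem_head : ∀ z ∈ existVars r₁, ∀ t ∈ termsOf H', σ₁ t = σ₁ (Sum.inl z) → t = Sum.inl z
  notMem_of_mem_body : ∀ z ∈ existVars r₁, ∀ t ∈ termsOf Q', σ₂ t = σ₁ (Sum.inl z) →
    t ∉ termsOf (bodySet r₂ \ Q')

theorem DependsOn.exists_isUnification (h : DependsOn r₂ r₁) :
    ∃ (Q' H' : Set (Atom V)) (σ₂ σ₁ : Term V → Term (V ⊕ V)),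
      IsUnification r₂ r₁ Q' H' σ₂ σ₁ := by
  obtain ⟨Q', H', P, hP⟩ := h
  obtain ⟨σ, hσ⟩ := hP.admissible.exists_isSubstitutionOf
  let ι₂ : Term V → Term (V ⊕ V) := Sum.map Sum.inl id
  let ι₁ : Term V → Term (V ⊕ V) := Sum.map Sum.inr id
  obtain ⟨Q₀, hQ₀, rfl⟩ : ∃ Q₀ ⊆ bodySet r₂, Atom.map ι₂ '' Q₀ = Q' :=
    Set.subset_image_iff.1 (bodySet_rename Sum.inl r₂ ▸ hP.subset_query)
  obtain ⟨H₀, hH₀, rfl⟩ : ∃ H₀ ⊆ headSet r₁, Atom.map ι₁ '' H₀ = H' :=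
    Set.subset_image_iff.1 (headSet_rename Sum.inr r₁ ▸ hP.subset_head)
  have existVar {z : V} (hz : z ∈ existVars r₁) :
      (Sum.inr z : V ⊕ V) ∈ existVars (r₁.rename Sum.inr) :=
    existVars_rename Sum.inr_injective ▸ Set.mem_image_of_mem _ hz
  have mem_body {t : Term V} (ht : t ∈ termsOf Q₀) :
      ι₂ t ∈ termsOf (Atom.map ι₂ '' Q₀ ∪ Atom.map ι₁ '' H₀) :=
    let ⟨a, ha, hta⟩ := ht; ⟨_, .inl ⟨a, ha, rfl⟩, List.mem_map_of_mem hta⟩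
  have mem_head {t : Term V} (ht : t ∈ termsOf H₀) :
      ι₁ t ∈ termsOf (Atom.map ι₂ '' Q₀ ∪ Atom.map ι₁ '' H₀) :=
    let ⟨a, ha, hta⟩ := ht; ⟨_, .inr ⟨a, ha, rfl⟩, List.mem_map_of_mem hta⟩
  refine ⟨Q₀, H₀, σ ∘ ι₂, σ ∘ ι₁, hP.nonempty.of_image, hQ₀, hH₀, fun a ha => ?_,
    fun z hz t ht hzt => ?_, fun z hz t ht hzt => ?_⟩
  · have ha' := Set.mem_image_of_mem (Atom.map σ) (Set.mem_image_of_mem (Atom.map ι₂) ha)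
    rw [← hP.unifies σ hσ] at ha'
    obtain ⟨_, ⟨b, hb, rfl⟩, hab⟩ := ha'
    exact ⟨b, hb, by simpa [Atom.map] using hab⟩
  · by_contra hne
    have hne' : ι₁ t ≠ Sum.inl (Sum.inr z) := by cases t <;> simp_all [ι₁]
    obtain ⟨x, hx, htx, -⟩ := hP.exists_eq_inl_of_apply_eq hσ (existVar hz) (mem_head ht) hne' hzt
    rw [varsOf_image_map] at hx
    obtain ⟨x, -, rfl⟩ := hx
    cases t <;> simp [ι₁] at htx
  · rintro ⟨a, ⟨ha, haQ⟩, hta⟩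
    have hne : ι₂ t ≠ Sum.inl (Sum.inr z) := by cases t <;> simp [ι₂]
    obtain ⟨x, -, htx, hx⟩ := hP.exists_eq_inl_of_apply_eq hσ (existVar hz) (mem_body ht) hne hzt
    have hι₂ : Function.Injective ι₂ := Sum.inl_injective.sumMap Function.injective_id
    refine hx ⟨Atom.map ι₂ a, ⟨bodySet_rename Sum.inl r₂ ▸ Set.mem_image_of_mem _ ha, ?_⟩,
      htx ▸ List.mem_map_of_mem hta⟩
    rwa [(Atom.map_injective hι₂).mem_set_image]

theorem not_dependsOn_of_forall_fst_ne (h : ∀ a ∈ bodySet r₂, ∀ b ∈ headSet r₁, a.1 ≠ b.1) :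
    ¬ DependsOn r₂ r₁ := by
  intro hdep
  obtain ⟨Q', H', σ₂, σ₁, hU⟩ := hdep.exists_isUnification
  obtain ⟨a, ha⟩ := hU.nonempty
  obtain ⟨b, hb, hab⟩ := hU.unifies a ha
  exact h a (hU.subset_body ha) b (hU.subset_head hb) (congrArg Prod.fst hab).symm

theorem isAGRD_union {A B : Set (Rule V)} (hA : ∀ r ∈ A, ∀ s ∈ A ∪ B, ¬ DependsOn s r)
    (hB : ∀ r ∈ B, ∀ s ∈ B, ¬ DependsOn s r) : IsAGRD (A ∪ B) := by
  have mem_right {r s : Rule V} (h : GRD (A ∪ B) r s) : r ∈ B :=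
    h.1.resolve_left fun hr => hA r hr s h.2.1 h.2.2
  intro r hr
  obtain ⟨s, hrs, -⟩ := Relation.TransGen.head'_iff.1 hr
  obtain ⟨t, -, htr⟩ := Relation.TransGen.tail'_iff.1 hr
  exact hB t (mem_right htr) r (mem_right hrs) htr.2.2

theorem IsAGRDSingleTrans.isAGRDTrans {K : KB} (h : IsAGRDSingleTrans K) : IsAGRDTrans K := by
  obtain ⟨hp, Ra, t, hRa, ht, hK⟩ := h
  exact ⟨hp, Ra, {t}, hRa, by rintro r rfl; exact ht, hK⟩

end

/-! ### Rules without constants and with a single head atom -/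

section
variable {V W D P : Type}

theorem Interp.satAtom_map (I : Interp D) (v : W → D) (f : V → W) (a : Atom V) :
    I.SatAtom v (Atom.map (Sum.map f id) a) ↔ I.SatAtom (v ∘ f) a := by
  have : I.eval v ∘ Sum.map f id = I.eval (v ∘ f) := by
    ext t; cases t <;> rfl
  simp only [SatAtom, Atom.map, List.map_map, this]

theorem Interp.satAtom_congr (I : Interp D) {v w : V → D} {a : Atom V}
    (h : ∀ t ∈ a.2, I.eval v t = I.eval w t) : I.SatAtom v a ↔ I.SatAtom w a := by
  rw [SatAtom, SatAtom, List.map_congr_left h]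

/-- The interpretation in which a predicate named `name p` holds of the lists given by `rel p`, and
in which the names not of this form denote empty relations. -/
def Interp.ofPredicates (name : P → ℕ) (const : ℕ → D) (rel : P → List D → Prop) : Interp D where
  const := const
  rel n l := ∃ p, name p = n ∧ rel p l

theorem Interp.ofPredicates_rel {name : P → ℕ} (hname : Function.Injective name) {const : ℕ → D}
    {rel : P → List D → Prop} {p : P} {l : List D} :
    (ofPredicates name const rel).rel (name p) l ↔ rel p l := by
  refine ⟨?_, fun h => ⟨p, rfl, h⟩⟩
  rintro ⟨q, hq, h⟩
  rwa [← hname hq]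

/-- The rule with body `B` and head `h` whose atoms, which contain no constants, are given as
predicates applied to lists of variables. -/
def clause (B : List (ℕ × List V)) (h : ℕ × List V) : Rule V :=
  (B.map fun a => (a.1, a.2.map Sum.inl), [(h.1, h.2.map Sum.inl)])

variable {B : List (ℕ × List V)} {h : ℕ × List V}

theorem clause_proper (hB : B ≠ []) : (clause B h).Proper :=
  ⟨mt List.map_eq_nil_iff.1 hB, List.cons_ne_nil _ _⟩

theorem mem_varsOf_bodySet_clause {x : V} :
    x ∈ varsOf (bodySet (clause B h)) ↔ ∃ a ∈ B, x ∈ a.2 := by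
  simp [varsOf, termsOf, bodySet, Rule.body, clause]

theorem Interp.satRule_clause {I : Interp D} : I.SatRule (clause B h) ↔
    ∀ v : V → D, (∀ a ∈ B, I.rel a.1 (a.2.map v)) →
      ∃ w : V → D, (∀ a ∈ B, ∀ x ∈ a.2, w x = v x) ∧ I.rel h.1 (h.2.map w) := by
  have satAtom_vars (v : V → D) (n : ℕ) (l : List V) :
      I.SatAtom v (n, l.map Sum.inl) ↔ I.rel n (l.map v) := by
    rw [SatAtom, List.map_map]; rfl
  have agree (v w : V → D) : (∀ x ∈ varsOf (bodySet (clause B h)), w x = v x) ↔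
      ∀ a ∈ B, ∀ x ∈ a.2, w x = v x := by
    simp only [mem_varsOf_bodySet_clause]
    exact ⟨fun hw a ha x hx => hw x ⟨a, ha, hx⟩, fun hw x ⟨a, ha, hx⟩ => hw a ha x hx⟩
  simp only [SatRule, agree]
  simp only [clause, Rule.body, Rule.head, List.forall_mem_map, List.forall_mem_singleton,
    satAtom_vars]

theorem Interp.satRule_clause_of_subset {I : Interp D} (hB : ∀ x ∈ h.2, ∃ a ∈ B, x ∈ a.2) :
    I.SatRule (clause B h) ↔
      ∀ v : V → D, (∀ a ∈ B, I.rel a.1 (a.2.map v)) → I.rel h.1 (h.2.map v) := by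
  rw [satRule_clause]
  refine forall₂_congr fun v _ => ⟨?_, fun hv => ⟨v, fun _ _ _ _ => rfl, hv⟩⟩
  rintro ⟨w, hwv, hw⟩
  have : h.2.map w = h.2.map v := List.map_congr_left fun x hx =>
    let ⟨a, ha, hxa⟩ := hB x hx; hwv a ha x hxa
  rwa [← this]

end

/-! ### Splitting a rule -/

/-- The predicates of a split knowledge base: those of the original knowledge base, the transitive
predicate `link`, and a predicate `trig r` for the triggers of each rule `r`. -/
inductive SplitPred
  | base (n : ℕ)
  | link
  | trig (r : Rule ℕ)

/-- The name of a predicate of a split knowledge base. -/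
def SplitPred.name : SplitPred → ℕ
  | base n => 2 * n
  | link => 1
  | trig r => 2 * Encodable.encode r + 3

theorem SplitPred.name_injective : Function.Injective SplitPred.name := by
  rintro (n | _ | r) (m | _ | s) h <;> simp only [name] at h <;> try omega
  · rw [show n = m by omega]
  · rfl
  · rw [Encodable.encode_injective (show Encodable.encode r = Encodable.encode s by omega)]

/-- The renaming of the predicate of an atom or of a fact to its name in a split knowledge base. -/
def toBase {α : Type} (a : ℕ × α) : ℕ × α := ((SplitPred.base a.1).name, a.2)

/-- An atom of a rule as it occurs in the split rules, which have two additional variables `0` and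
`1`. -/
def liftAtom (a : Atom ℕ) : Atom ℕ := toBase (Atom.map (Sum.map (· + 2) id) a)

/-- The atom that states that `x` is linked to `y`. -/
def linkAtom (x y : ℕ) : Atom ℕ := (SplitPred.link.name, [Sum.inl x, Sum.inl y])

/-- The terms of the body of a rule. -/
def bodyTerms (r : Rule ℕ) : List (Term ℕ) := (Rule.body r).flatMap Prod.snd

/-- The atom that states that the variable `0` is a trigger of the rule `r`, that is, that it
witnesses a match of the body of `r`. -/
def trigAtom (r : Rule ℕ) : Atom ℕ :=
  ((SplitPred.trig r).name, Sum.inl 0 :: (bodyTerms r).map (Sum.map (· + 2) id))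

/-- The rule that creates a trigger of the rule `r` for each match of the body of `r`. The new
trigger is linked in both directions to a second new element, hence to itself once the links are
closed under transitivity, but not before. -/
def trigRule (r : Rule ℕ) : Rule ℕ :=
  ((Rule.body r).map liftAtom, [trigAtom r, linkAtom 0 1, linkAtom 1 0])

/-- The rule that produces the head of the rule `r` from a trigger of `r` linked to itself. -/
def fireRule (r : Rule ℕ) : Rule ℕ := ([trigAtom r, linkAtom 0 0], (Rule.head r).map liftAtom)

/-- The transitivity rule for links. -/
def linkTrans : Rule ℕ :=
  clause [(SplitPred.link.name, [0, 1]), (SplitPred.link.name, [1, 2])]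
    (SplitPred.link.name, [0, 2])

/-- The rules that simulate the rules of `R`. -/
def splitRules (R : List (Rule ℕ)) : List (Rule ℕ) :=
  R.map trigRule ++ R.map fireRule ++ [linkTrans]

section
variable {r s : Rule ℕ} {R : List (Rule ℕ)}

theorem mem_bodyTerms {t : Term ℕ} : t ∈ bodyTerms r ↔ t ∈ termsOf (bodySet r) :=
  List.mem_flatMap

theorem mem_varsOf_bodySet_trigRule {n : ℕ} :
    n ∈ varsOf (bodySet (trigRule r)) ↔ ∃ m ∈ varsOf (bodySet r), m + 2 = n := by
  rw [← Set.mem_image, ← varsOf_image_map]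
  simp only [varsOf, termsOf, Set.mem_ofPred_eq, Set.exists_mem_image, bodySet, trigRule, Rule.body,
    List.mem_map, liftAtom, toBase, exists_exists_and_eq_and]

theorem mem_varsOf_bodySet_fireRule {n : ℕ} :
    n ∈ varsOf (bodySet (fireRule r)) ↔ n = 0 ∨ ∃ m ∈ varsOf (bodySet r), m + 2 = n := by
  simp +contextual [varsOf, termsOf, bodySet, fireRule, Rule.body, trigAtom, linkAtom, bodyTerms]

theorem zero_mem_existVars_trigRule : 0 ∈ existVars (trigRule r) := by
  refine ⟨⟨trigAtom r, List.mem_cons_self, List.mem_cons_self⟩, ?_⟩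
  simp [mem_varsOf_bodySet_trigRule]

theorem not_dependsOn_fireRule_trigRule : ¬ DependsOn (fireRule s) (trigRule r) := by
  intro h
  obtain ⟨Q', H', σ₂, σ₁, hU⟩ := h.exists_isUnification
  have mem_head {b : Atom ℕ} (hb : b ∈ H') :
      b = trigAtom r ∨ b = linkAtom 0 1 ∨ b = linkAtom 1 0 := by
    simpa [headSet, trigRule, Rule.head] using hU.subset_head hb
  have trig_ne_link (t : Rule ℕ) : (SplitPred.trig t).name ≠ SplitPred.link.name :=
    SplitPred.name_injective.ne nofun
  have link_notMem : linkAtom 0 0 ∉ Q' := by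
    intro hQ
    obtain ⟨b, hb, hab⟩ := hU.unifies _ hQ
    obtain ⟨h01, h1⟩ : σ₁ (Sum.inl 1) = σ₁ (Sum.inl 0) ∧ Sum.inl 1 ∈ b.2 := by
      rcases mem_head hb with rfl | rfl | rfl
      · exact absurd (congrArg Prod.fst hab) (trig_ne_link r)
      all_goals
        simp only [linkAtom, Atom.map, List.map_cons, List.cons.injEq, Prod.mk.injEq] at hab
        simp [linkAtom, hab]
    simpa using hU.eq_of_mem_head 0 zero_mem_existVars_trigRule _ ⟨b, hb, h1⟩ h01
  have trig_mem : trigAtom s ∈ Q' := by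
    obtain ⟨a, ha⟩ := hU.nonempty
    obtain rfl | rfl : a = trigAtom s ∨ a = linkAtom 0 0 := by
      simpa [bodySet, fireRule, Rule.body] using hU.subset_body ha
    · exact ha
    · exact absurd ha link_notMem
  have h0 : σ₂ (Sum.inl 0) = σ₁ (Sum.inl 0) := by
    obtain ⟨b, hb, hab⟩ := hU.unifies _ trig_mem
    rcases mem_head hb with rfl | rfl | rfl
    · exact (List.head_eq_of_cons_eq (congrArg Prod.snd hab)).symm
    all_goals exact absurd (congrArg Prod.fst hab) (trig_ne_link s).symm
  refine hU.notMem_of_mem_body 0 zero_mem_existVars_trigRule _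
    ⟨_, trig_mem, List.mem_cons_self⟩ h0 ⟨linkAtom 0 0, ⟨?_, link_notMem⟩, List.mem_cons_self⟩
  simp [bodySet, fireRule, Rule.body]

theorem not_dependsOn_trigRule_trigRule : ¬ DependsOn (trigRule s) (trigRule r) := by
  refine not_dependsOn_of_forall_fst_ne (List.forall_mem_map.2 fun a _ => ?_)
  simp [headSet, trigRule, Rule.head, liftAtom, toBase, trigAtom, linkAtom,
    SplitPred.name_injective.eq_iff]

theorem not_dependsOn_fireRule_fireRule : ¬ DependsOn (fireRule s) (fireRule r) := by
  refine not_dependsOn_of_forall_fst_ne fun b hb => List.forall_mem_map.2 fun a _ => ?_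
  revert b
  simp [bodySet, fireRule, Rule.body, liftAtom, toBase, trigAtom, linkAtom,
    SplitPred.name_injective.eq_iff]

theorem isAGRD_trigRule_union_fireRule (R : Set (Rule ℕ)) :
    IsAGRD (trigRule '' R ∪ fireRule '' R) := by
  refine isAGRD_union ?_ ?_
  · rintro _ ⟨r, -, rfl⟩ _ (⟨s, -, rfl⟩ | ⟨s, -, rfl⟩)
    · exact not_dependsOn_trigRule_trigRule
    · exact not_dependsOn_fireRule_trigRule
  · rintro _ ⟨r, -, rfl⟩ _ ⟨s, -, rfl⟩
    exact not_dependsOn_fireRule_fireRule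

theorem isTransitivityRule_linkTrans : IsTransitivityRule linkTrans :=
  ⟨SplitPred.link.name, 0, 1, 2, by decide, by decide, by decide,
    by ext; simp [bodySet, linkTrans, clause, Rule.body],
    by ext; simp [headSet, linkTrans, clause, Rule.head]⟩

theorem proper_of_mem_splitRules (hR : ∀ r ∈ R, r.Proper) (hr : r ∈ splitRules R) :
    r.Proper := by
  simp only [splitRules, List.mem_append, List.mem_map, List.mem_singleton] at hr
  rcases hr with (⟨s, hs, rfl⟩ | ⟨s, hs, rfl⟩) | rfl
  · exact ⟨mt List.map_eq_nil_iff.1 (hR s hs).1, List.cons_ne_nil _ _⟩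
  · exact ⟨List.cons_ne_nil _ _, mt List.map_eq_nil_iff.1 (hR s hs).2⟩
  · exact clause_proper (List.cons_ne_nil _ _)

theorem isAGRDSingleTrans_splitRules (F : List Fact) (hR : ∀ r ∈ R, r.Proper) :
    IsAGRDSingleTrans (F, splitRules R) := by
  refine ⟨fun r => proper_of_mem_splitRules hR, _, linkTrans,
    isAGRD_trigRule_union_fireRule {r | r ∈ R}, isTransitivityRule_linkTrans, ?_⟩
  ext r
  simp only [KB.ruleSet, KB.rules, splitRules, List.mem_append, List.mem_map, List.mem_singleton,
    Set.mem_union, Set.mem_image, Set.mem_ofPred_eq, Set.mem_singleton_iff]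

end

/-! ### Splitting preserves entailment -/

namespace Interp
variable {D : Type} (I : Interp D) {r : Rule ℕ}

/-- The restriction of an interpretation of the predicates of a split knowledge base to those of the
original one. -/
def restrict : Interp D where
  const := I.const
  rel n := I.rel (SplitPred.base n).name

theorem satAtom_liftAtom {v : ℕ → D} {a : Atom ℕ} :
    I.SatAtom v (liftAtom a) ↔ I.restrict.SatAtom (v ∘ (· + 2)) a :=
  I.restrict.satAtom_map v _ a

theorem satRule_linkTrans : I.SatRule linkTrans ↔ ∀ x y z, I.rel SplitPred.link.name [x, y] →
    I.rel SplitPred.link.name [y, z] → I.rel SplitPred.link.name [x, z] := by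
  rw [linkTrans, satRule_clause_of_subset (by simp)]
  simp only [List.forall_mem_cons, List.map_cons, List.map_nil]
  exact ⟨fun h x y z hxy hyz => h ([x, y, z].getD · z) ⟨hxy, hyz, nofun⟩,
    fun h v hv => h _ _ _ hv.1 hv.2.1⟩

variable {I} in
theorem restrict_satRule (h : I.SatRule linkTrans) (hTrig : I.SatRule (trigRule r))
    (hFire : I.SatRule (fireRule r)) : I.restrict.SatRule r := by
  intro v hv
  obtain ⟨w, hwv, hw⟩ := hTrig (fun n => v (n - 2)) (List.forall_mem_map.2 fun a ha =>
    I.satAtom_liftAtom.2 (hv a ha))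
  simp only [trigRule, Rule.head, List.forall_mem_cons] at hw
  have hlink : I.SatAtom w (linkAtom 0 0) := I.satRule_linkTrans.1 h _ _ _ hw.2.1 hw.2.2.1
  obtain ⟨u, huw, hu⟩ := hFire w (by
    simp only [fireRule, Rule.body, List.forall_mem_cons]
    exact ⟨hw.1, hlink, nofun⟩)
  refine ⟨u ∘ (· + 2), fun x hx => ?_, fun a ha => ?_⟩
  · exact (huw _ (mem_varsOf_bodySet_fireRule.2 (.inr ⟨x, hx, rfl⟩))).trans
      (hwv _ (mem_varsOf_bodySet_trigRule.2 ⟨x, hx, rfl⟩))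
  · exact I.satAtom_liftAtom.1 (hu _ (List.mem_map_of_mem ha))

/-- The relations denoted by the predicates of a split knowledge base in `I.expand`: any two
elements are linked, and every element is a trigger of all matches of rule bodies. -/
def SplitHolds : SplitPred → List D → Prop
  | .base n, l => I.rel n l
  | .link, _ => True
  | .trig r, l => ∃ (d : D) (v : ℕ → D), l = d :: (bodyTerms r).map (I.eval v) ∧
      ∀ a ∈ Rule.body r, I.SatAtom v a

/-- The expansion of an interpretation to the predicates of a split knowledge base. -/
def expand : Interp D := ofPredicates SplitPred.name I.const I.SplitHolds

theorem expand_rel (p : SplitPred) {l : List D} : I.expand.rel p.name l ↔ I.SplitHolds p l :=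
  ofPredicates_rel SplitPred.name_injective

theorem restrict_expand : I.expand.restrict = I :=
  congrArg (Interp.mk I.const) <| funext₂ fun _ _ => propext (I.expand_rel _)

theorem expand_satAtom_linkAtom (v : ℕ → D) (x y : ℕ) : I.expand.SatAtom v (linkAtom x y) :=
  (I.expand_rel .link).2 trivial

theorem expand_satAtom_liftAtom {v : ℕ → D} {a : Atom ℕ} :
    I.expand.SatAtom v (liftAtom a) ↔ I.SatAtom (v ∘ (· + 2)) a := by
  rw [satAtom_liftAtom, restrict_expand]

theorem expand_satAtom_trigAtom {v : ℕ → D} : I.expand.SatAtom v (trigAtom r) ↔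
    ∃ u : ℕ → D, (∀ t ∈ bodyTerms r, I.eval (v ∘ (· + 2)) t = I.eval u t) ∧
      ∀ a ∈ Rule.body r, I.SatAtom u a := by
  have eval_lift : I.expand.eval v ∘ Sum.map (· + 2) id = I.eval (v ∘ (· + 2)) := by
    ext t; cases t <;> rfl
  refine (I.expand_rel (.trig r)).trans ?_
  simp only [SplitHolds, trigAtom, List.map_cons, List.map_map, eval_lift,
    List.cons.injEq, List.map_inj_left]
  exact ⟨fun ⟨_, u, ⟨_, huv⟩, hu⟩ => ⟨u, huv, hu⟩, fun ⟨u, huv, hu⟩ => ⟨_, u, ⟨rfl, huv⟩, hu⟩⟩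

theorem expand_satRule_linkTrans : I.expand.SatRule linkTrans :=
  I.expand.satRule_linkTrans.2 fun _ _ _ _ _ => (I.expand_rel .link).2 trivial

theorem expand_satRule_trigRule : I.expand.SatRule (trigRule r) := by
  refine fun v hv => ⟨v, fun _ _ => rfl, ?_⟩
  have hv := fun a ha => I.expand_satAtom_liftAtom.1 (List.forall_mem_map.1 hv a ha)
  simp only [trigRule, Rule.head, List.forall_mem_cons]
  exact ⟨I.expand_satAtom_trigAtom.2 ⟨_, fun _ _ => rfl, hv⟩, I.expand_satAtom_linkAtom _ _ _,
    I.expand_satAtom_linkAtom _ _ _, nofun⟩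

variable {I} in
theorem SatRule.expand_fireRule (h : I.SatRule r) : I.expand.SatRule (fireRule r) := by
  intro v hv
  obtain ⟨u, huv, hu⟩ := I.expand_satAtom_trigAtom.1 (hv (trigAtom r) List.mem_cons_self)
  obtain ⟨w, hwv, hw⟩ := h (v ∘ (· + 2)) fun a ha =>
    (I.satAtom_congr fun t ht => huv t (mem_bodyTerms.2 ⟨a, ha, ht⟩)).2 (hu a ha)
  refine ⟨fun | 0 => v 0 | 1 => v 1 | n + 2 => w n, fun x hx => ?_, ?_⟩
  · rcases mem_varsOf_bodySet_fireRule.1 hx with rfl | ⟨y, hy, rfl⟩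
    · rfl
    · exact hwv y hy
  · exact List.forall_mem_map.2 fun a ha => I.expand_satAtom_liftAtom.2 (hw a ha)

end Interp

theorem entails_splitRules {F : List Fact} {R : List (Rule ℕ)} {q : Atom ℕ} :
    Entails (F.map toBase, splitRules R) (toBase q) ↔ Entails (F, R) q := by
  constructor
  · rintro h D I ⟨hF, hR⟩
    rw [← I.restrict_expand] at hF ⊢
    refine h D I.expand ⟨List.forall_mem_map.2 hF, fun r hr => ?_⟩
    simp only [KB.rules, splitRules, List.mem_append, List.mem_map, List.mem_singleton] at hr
    rcases hr with (⟨s, -, rfl⟩ | ⟨s, hs, rfl⟩) | rfl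
    · exact I.expand_satRule_trigRule
    · exact (hR s hs).expand_fireRule
    · exact I.expand_satRule_linkTrans
  · rintro h D I ⟨hF, hR⟩
    simp only [KB.rules, splitRules, List.forall_mem_append, List.forall_mem_map,
      List.forall_mem_singleton] at hR
    obtain ⟨⟨hTrig, hFire⟩, hTrans⟩ := hR
    exact h D I.restrict ⟨fun f hf => hF _ (List.mem_map_of_mem hf),
      fun r hr => Interp.restrict_satRule hTrans (hTrig r hr) (hFire r hr)⟩

/-! ### Rules for partial recursive functions -/

open Nat.Partrec (Code)

/-- The predicates for zero, for the graphs of the successor, of the arithmetical operations and of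
the pairing function, and for the graph of the partial function computed by each code. -/
inductive ArithPred
  | zero
  | succ
  | add
  | mul
  | pair
  | graph (c : Code)

open ArithPred

/-- The name of an arithmetical predicate. -/
def ArithPred.name : ArithPred → ℕ
  | zero => 0
  | succ => 1
  | add => 2
  | mul => 3
  | pair => 4
  | graph c => Encodable.encode c + 5

/-- Allows writing an arithmetical predicate for its name. -/
instance : Coe ArithPred ℕ := ⟨ArithPred.name⟩

theorem ArithPred.name_injective : Function.Injective ArithPred.name := by
  rintro (_ | _ | _ | _ | _ | c) (_ | _ | _ | _ | _ | d) h <;> simp only [name] at h <;>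
    first
    | rfl
    | omega
    | rw [Encodable.encode_injective (Nat.add_right_cancel h)]

/-- Every successor has a successor. This is the only rule with an existential variable. -/
def succRule : Rule ℕ := clause [(succ, [0, 1])] (succ, [1, 2])

/-- The rules that define addition, multiplication and pairing; the last two are the two cases of
the definition of `Nat.pair`. -/
def arithRules : List (Rule ℕ) :=
  [clause [(succ, [0, 1]), (zero, [2])] (add, [0, 2, 0]),
   clause [(add, [0, 1, 2]), (succ, [1, 3]), (succ, [2, 4])] (add, [0, 3, 4]),
   clause [(succ, [0, 1]), (zero, [2])] (mul, [0, 2, 2]),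
   clause [(mul, [0, 1, 2]), (succ, [1, 3]), (add, [2, 0, 4])] (mul, [0, 3, 4]),
   clause [(succ, [0, 1]), (add, [1, 2, 3]), (mul, [3, 3, 4]), (add, [4, 0, 5])] (pair, [0, 3, 5]),
   clause [(add, [0, 1, 2]), (mul, [2, 2, 3]), (add, [3, 2, 4]), (add, [4, 0, 5])]
     (pair, [2, 0, 5])]

/-- The rules that define the graph of the function computed by a code from the graphs of the
functions computed by its immediate subcodes. -/
def definingRules : Code → List (Rule ℕ)
  | .zero => [clause [(succ, [0, 1]), (zero, [2])] (graph .zero, [0, 2])]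
  | .succ => [clause [(succ, [0, 1])] (graph .succ, [0, 1])]
  | .left => [clause [(pair, [0, 1, 2])] (graph .left, [2, 0])]
  | .right => [clause [(pair, [0, 1, 2])] (graph .right, [2, 1])]
  | .pair f g =>
    [clause [(graph f, [0, 1]), (graph g, [0, 2]), (pair, [1, 2, 3])] (graph (.pair f g), [0, 3])]
  | .comp f g => [clause [(graph g, [0, 1]), (graph f, [1, 2])] (graph (.comp f g), [0, 2])]
  | .prec f g =>
    [clause [(zero, [0]), (pair, [1, 0, 2]), (graph f, [1, 3])] (graph (.prec f g), [2, 3]),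
     clause [(pair, [0, 1, 2]), (graph (.prec f g), [2, 3]), (pair, [1, 3, 4]), (pair, [0, 4, 5]),
        (graph g, [5, 6]), (succ, [1, 7]), (pair, [0, 7, 8])] (graph (.prec f g), [8, 6])]
  | .rfind' f =>
    [clause [(pair, [0, 1, 2]), (graph f, [2, 3]), (zero, [3])] (graph (.rfind' f), [2, 1]),
     clause [(pair, [0, 1, 2]), (graph f, [2, 3]), (succ, [4, 3]), (succ, [1, 5]),
        (pair, [0, 5, 6]), (graph (.rfind' f), [6, 7])] (graph (.rfind' f), [2, 7])]

/-- The codes that occur in a code, including itself. -/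
def subcodes : Code → List Code
  | .zero => [.zero]
  | .succ => [.succ]
  | .left => [.left]
  | .right => [.right]
  | .pair f g => .pair f g :: (subcodes f ++ subcodes g)
  | .comp f g => .comp f g :: (subcodes f ++ subcodes g)
  | .prec f g => .prec f g :: (subcodes f ++ subcodes g)
  | .rfind' f => .rfind' f :: subcodes f

/-- The rules that compute the partial function given by a code. -/
def programRules (c : Code) : List (Rule ℕ) :=
  succRule :: (arithRules ++ (subcodes c).flatMap definingRules)

/-- The facts that make the constants `n + 1, n, …, 0` denote the numbers `0, 1, …, n + 1`. Counting
downwards lets the constant `1` denote the input `n` whatever `n` is. -/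
def numeralFacts (n : ℕ) : List Fact :=
  (zero, [n + 1]) :: (List.range (n + 1)).map fun j => (succ, [j + 1, j])

/-- The query whether the function computed by `c` has a value at the input. -/
def haltQuery (c : Code) : Atom ℕ := (graph c, [Sum.inr 1, Sum.inl 0])

theorem proper_of_mem_definingRules {c : Code} {r : Rule ℕ} (hr : r ∈ definingRules c) :
    r.Proper := by
  cases c <;> simp only [definingRules, List.mem_cons, List.not_mem_nil, or_false] at hr
  case prec | rfind' => obtain rfl | rfl := hr <;> exact clause_proper (List.cons_ne_nil _ _)
  all_goals exact hr ▸ clause_proper (List.cons_ne_nil _ _)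

theorem proper_of_mem_programRules {c : Code} {r : Rule ℕ} (hr : r ∈ programRules c) :
    r.Proper := by
  simp only [programRules, List.mem_cons, List.mem_append, List.mem_flatMap] at hr
  rcases hr with rfl | hr | ⟨d, -, hr⟩
  · exact clause_proper (List.cons_ne_nil _ _)
  · simp only [arithRules, List.mem_cons, List.not_mem_nil, or_false] at hr
    rcases hr with rfl | rfl | rfl | rfl | rfl | rfl <;> exact clause_proper (List.cons_ne_nil _ _)
  · exact proper_of_mem_definingRules hr

/-! ### The standard model -/

section
variable {f g : Code} {a b m n x y z : ℕ}

theorem mem_eval_pair :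
    z ∈ (Code.pair f g).eval x ↔ ∃ a ∈ f.eval x, ∃ b ∈ g.eval x, Nat.pair a b = z := by
  simp [Code.eval, Seq.seq]

theorem mem_eval_comp : z ∈ (Code.comp f g).eval x ↔ ∃ y ∈ g.eval x, z ∈ f.eval y :=
  Part.mem_bind_iff

theorem mem_eval_prec_succ : z ∈ (Code.prec f g).eval (Nat.pair a (n + 1)) ↔
    ∃ y ∈ (Code.prec f g).eval (Nat.pair a n), z ∈ g.eval (Nat.pair a (Nat.pair n y)) := by
  rw [Code.eval_prec_succ]
  exact Part.mem_bind_iff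

theorem mem_eval_rfind' : y ∈ (Code.rfind' f).eval (Nat.pair a m) ↔
    ∃ n, n + m = y ∧ 0 ∈ f.eval (Nat.pair a (n + m)) ∧
      ∀ k < n, ∃ z, z + 1 ∈ f.eval (Nat.pair a (k + m)) := by
  have exists_succ (p : Part ℕ) : (∃ z ∈ p, z ≠ 0) ↔ ∃ z, z + 1 ∈ p :=
    ⟨fun ⟨z, hz, h0⟩ => ⟨z - 1, by rwa [Nat.sub_one_add_one h0]⟩, fun ⟨z, hz⟩ => ⟨_, hz, nofun⟩⟩
  simp only [Code.eval, Nat.unpaired, Nat.unpair_pair, Part.map_eq_map, Part.mem_map_iff]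
  refine exists_congr fun n => and_comm.trans <| and_congr_right fun _ => Nat.mem_rfind.trans ?_
  simp only [Part.mem_map_iff, decide_eq_true_eq, decide_eq_false_iff_not, exists_eq_right,
    exists_succ]

theorem le_of_mem_eval_rfind' (h : y ∈ (Code.rfind' f).eval (Nat.pair a m)) : m ≤ y := by
  obtain ⟨n, rfl, -⟩ := mem_eval_rfind'.1 h
  exact Nat.le_add_left _ _

theorem mem_eval_rfind'_iff : y ∈ (Code.rfind' f).eval (Nat.pair a m) ↔
    y = m ∧ 0 ∈ f.eval (Nat.pair a m) ∨
      (∃ z, z + 1 ∈ f.eval (Nat.pair a m)) ∧ y ∈ (Code.rfind' f).eval (Nat.pair a (m + 1)) := by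
  have shift (k : ℕ) : k + (m + 1) = k + 1 + m := by ring
  simp only [mem_eval_rfind', shift]
  constructor
  · rintro ⟨_ | n, rfl, h0, hn⟩
    · exact .inl ⟨Nat.zero_add m, by rwa [Nat.zero_add] at h0⟩
    · exact .inr ⟨by simpa using hn 0 n.succ_pos, n, rfl, h0, fun k hk => hn _ (by omega)⟩
  · rintro (⟨rfl, h0⟩ | ⟨hz, n, rfl, h0, hn⟩)
    · exact ⟨0, Nat.zero_add y, by rwa [Nat.zero_add], nofun⟩
    · refine ⟨n + 1, rfl, h0, ?_⟩
      rintro (_ | k) hk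
      · simpa using hz
      · exact hn k (by omega)

end

/-- The intended relation of an arithmetical predicate. -/
def ArithPred.Holds : ArithPred → List ℕ → Prop
  | zero, [x] => x = 0
  | succ, [x, y] => y = x + 1
  | add, [x, y, z] => z = x + y
  | mul, [x, y, z] => z = x * y
  | pair, [x, y, z] => z = Nat.pair x y
  | graph c, [x, y] => y ∈ c.eval x
  | _, _ => False

/-- The natural numbers as a model of `numeralFacts n` and of the rules of all programs. -/
def standardInterp (n : ℕ) : Interp ℕ :=
  .ofPredicates ArithPred.name (fun j => n + 1 - j) ArithPred.Holds

section
variable {n : ℕ} {c : Code} {r : Rule ℕ}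

theorem standardInterp_rel (p : ArithPred) {l : List ℕ} :
    (standardInterp n).rel p l ↔ p.Holds l :=
  Interp.ofPredicates_rel ArithPred.name_injective

theorem standardInterp_satRule_succRule : (standardInterp n).SatRule succRule := by
  refine Interp.satRule_clause.2 fun v _ => ⟨fun i => if i = 2 then v 1 + 1 else v i, ?_, ?_⟩
  · simp
  · simp [standardInterp_rel, Holds]

theorem standardInterp_satRule_of_mem_arithRules (hr : r ∈ arithRules) :
    (standardInterp n).SatRule r := by
  simp only [arithRules, List.mem_cons, List.not_mem_nil, or_false] at hr
  rcases hr with rfl | rfl | rfl | rfl | rfl | rfl <;>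
    rw [Interp.satRule_clause_of_subset (by simp)] <;> intro v hv <;>
    simp only [List.forall_mem_cons, List.map_cons, List.map_nil, standardInterp_rel, Holds]
      at hv ⊢
  · omega
  · omega
  · simp [hv.2.1]
  · obtain ⟨h₁, h₂, h₃, -⟩ := hv
    rw [h₃, h₂, h₁]; ring
  · rw [Nat.pair, if_pos (by omega)]
    omega
  · rw [Nat.pair, if_neg (by omega)]
    omega

theorem standardInterp_satRule_of_mem_definingRules (hr : r ∈ definingRules c) :
    (standardInterp n).SatRule r := by
  cases c <;> simp only [definingRules, List.mem_cons, List.not_mem_nil, or_false] at hr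
  case' prec f g => obtain hr | hr := hr
  case' rfind' f => obtain hr | hr := hr
  all_goals
    subst hr
    rw [Interp.satRule_clause_of_subset (by simp)]
    intro v hv
    simp only [List.forall_mem_cons, List.map_cons, List.map_nil, standardInterp_rel, Holds]
      at hv ⊢
  case zero | succ | left | right => simp [Code.eval, hv, pure, PFun.pure]
  case pair => exact mem_eval_pair.2 ⟨_, hv.1, _, hv.2.1, hv.2.2.1.symm⟩
  case comp => exact mem_eval_comp.2 ⟨_, hv.1, hv.2.1⟩
  case prec.inl =>
    obtain ⟨h0, hp, hf, -⟩ := hv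
    rwa [hp, h0, Code.eval_prec_zero]
  case prec.inr =>
    obtain ⟨h₂, h₃, h₄, h₅, h₆, h₇, h₈, -⟩ := hv
    rw [h₈, h₇, mem_eval_prec_succ, ← h₂]
    exact ⟨_, h₃, h₄ ▸ h₅ ▸ h₆⟩
  case rfind'.inl =>
    obtain ⟨h₂, hf, h₃, -⟩ := hv
    rw [h₂, mem_eval_rfind'_iff, ← h₂]
    exact .inl ⟨rfl, h₃ ▸ hf⟩
  case rfind'.inr =>
    obtain ⟨h₂, hf, h₃, h₅, h₆, h₇, -⟩ := hv
    rw [h₂, mem_eval_rfind'_iff, ← h₂, ← h₅, ← h₆]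
    exact .inr ⟨⟨_, h₃ ▸ hf⟩, h₇⟩

theorem standardInterp_isModel : (standardInterp n).IsModel (numeralFacts n, programRules c) := by
  constructor
  · simp only [numeralFacts, KB.facts, List.forall_mem_cons, List.forall_mem_map, List.mem_range]
    refine ⟨(standardInterp_rel zero).2 (Nat.sub_self _), fun j hj =>
      (standardInterp_rel succ).2 ?_⟩
    change n + 1 - j = n + 1 - (j + 1) + 1
    omega
  · intro r hr
    simp only [programRules, KB.rules, List.mem_cons, List.mem_append, List.mem_flatMap] at hr
    rcases hr with rfl | hr | ⟨d, -, hr⟩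
    · exact standardInterp_satRule_succRule
    · exact standardInterp_satRule_of_mem_arithRules hr
    · exact standardInterp_satRule_of_mem_definingRules hr

end

/-! ### Computations in arbitrary models -/

theorem exists_seq_extending {α : Type*} {r : α → α → Prop} (h : ∀ x y, r x y → ∃ z, r y z)
    (f : ℕ → α) {n : ℕ} (hf : ∀ i ≤ n, r (f i) (f (i + 1))) :
    ∃ e : ℕ → α, (∀ i ≤ n + 1, e i = f i) ∧ ∀ i, r (e i) (e (i + 1)) := by
  choose! next hnext using fun y (hy : ∃ x, r x y) => h hy.choose y hy.choose_spec
  let e : ℕ → α := Nat.rec (f 0) fun i d => if i ≤ n then f (i + 1) else next d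
  have he : ∀ i ≤ n + 1, e i = f i := by
    rintro (_ | i) hi
    · rfl
    · exact if_pos (Nat.le_of_succ_le_succ hi)
  refine ⟨e, he, fun i => ?_⟩
  induction i with
  | zero => simpa only [he _ (Nat.zero_le _), he (0 + 1) (by omega)] using hf 0 n.zero_le
  | succ i ih =>
    by_cases hi : i + 1 ≤ n
    · simpa only [he (i + 1) (by omega), he (i + 1 + 1) (by omega)] using hf _ hi
    · rw [show e (i + 1 + 1) = next (e (i + 1)) from if_neg hi]
      exact hnext _ ⟨_, ih⟩

section
variable {D : Type} {I : Interp D} {e : ℕ → D} {f g : Code}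

theorem Interp.SatRule.rel_succ (h : I.SatRule succRule) {x y : D} (hxy : I.rel succ [x, y]) :
    ∃ z, I.rel succ [y, z] := by
  obtain ⟨w, hwv, hw⟩ := satRule_clause.1 h ([x, y].getD · y) (by simpa using hxy)
  have hw1 : w 1 = y := hwv _ List.mem_cons_self 1 (by simp)
  exact ⟨w 2, by simpa [hw1] using hw⟩

theorem Interp.SatRule.rel_of_clause {B : List (ℕ × List ℕ)} {h : ℕ × List ℕ}
    (hr : I.SatRule (clause B h)) (hB : ∀ x ∈ h.2, ∃ a ∈ B, x ∈ a.2) (e : ℕ → D) (l : List ℕ)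
    (hl : ∀ a ∈ B, I.rel a.1 (a.2.map fun i => e (l.getD i 0))) :
    I.rel h.1 (h.2.map fun i => e (l.getD i 0)) :=
  (satRule_clause_of_subset hB).1 hr _ hl

/-- In the interpretation `I`, the image of `e` is a copy of the natural numbers, on which the
predicates for zero, the successor and pairing contain the intended relations. -/
structure Numerals (I : Interp D) (e : ℕ → D) : Prop where
  zero : I.rel zero [e 0]
  succ (x : ℕ) : I.rel succ [e x, e (x + 1)]
  pair (x y : ℕ) : I.rel pair [e x, e y, e (Nat.pair x y)]

theorem Interp.numerals_of_arithRules (h : ∀ r ∈ arithRules, I.SatRule r)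
    (h0 : I.rel zero [e 0]) (hs : ∀ x, I.rel succ [e x, e (x + 1)]) : Numerals I e := by
  simp only [arithRules, List.forall_mem_cons] at h
  obtain ⟨add_zero, add_succ, mul_zero, mul_succ, pair_lt, pair_ge, -⟩ := h
  have add (x y : ℕ) : I.rel add [e x, e y, e (x + y)] := by
    induction y with
    | zero => simpa [h0, hs] using add_zero.rel_of_clause (by simp) e [x, x + 1, 0]
    | succ y ih => simpa [ih, hs, ← add_assoc] using
        add_succ.rel_of_clause (by simp) e [x, y, x + y, y + 1, x + y + 1]
  have mul (x y : ℕ) : I.rel mul [e x, e y, e (x * y)] := by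
    induction y with
    | zero => simpa [h0, hs] using mul_zero.rel_of_clause (by simp) e [x, x + 1, 0]
    | succ y ih => simpa [ih, hs, add, mul_add] using
        mul_succ.rel_of_clause (by simp) e [x, y, x * y, y + 1, x * y + x]
  refine ⟨h0, hs, fun x y => ?_⟩
  rw [Nat.pair]
  split_ifs with hxy
  · obtain ⟨d, rfl⟩ := Nat.exists_eq_add_of_le (Nat.succ_le_of_lt hxy)
    simpa [hs, add, mul] using pair_lt.rel_of_clause (by simp) e
      [x, x + 1, d, x + 1 + d, (x + 1 + d) * (x + 1 + d), (x + 1 + d) * (x + 1 + d) + x]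
  · obtain ⟨d, rfl⟩ := Nat.exists_eq_add_of_le (not_lt.1 hxy)
    simpa [hs, add, mul] using pair_ge.rel_of_clause (by simp) e
      [y, d, y + d, (y + d) * (y + d), (y + d) * (y + d) + (y + d),
        (y + d) * (y + d) + (y + d) + y]

/-- The predicate for the graph of the function computed by `c` contains, on the numerals `e`, the
graph of this function. -/
def Represents (I : Interp D) (e : ℕ → D) (c : Code) : Prop :=
  ∀ x, ∀ y ∈ c.eval x, I.rel (graph c) [e x, e y]

theorem represents_comp (h : ∀ r ∈ definingRules (.comp f g), I.SatRule r)
    (hf : Represents I e f) (hg : Represents I e g) : Represents I e (.comp f g) := by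
  intro x z hz
  obtain ⟨y, hy, hz⟩ := mem_eval_comp.1 hz
  simpa [hg x y hy, hf y z hz] using
    (h _ List.mem_cons_self).rel_of_clause (by simp) e [x, y, z]

namespace Numerals

theorem represents_zero (he : Numerals I e) (h : ∀ r ∈ definingRules .zero, I.SatRule r) :
    Represents I e .zero := by
  intro x y hy
  obtain rfl : y = 0 := by simpa [Code.eval, pure, PFun.pure] using hy
  simpa [he.zero, he.succ] using (h _ List.mem_cons_self).rel_of_clause (by simp) e [x, x + 1, 0]

theorem represents_succ (he : Numerals I e) (h : ∀ r ∈ definingRules .succ, I.SatRule r) :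
    Represents I e .succ := by
  intro x y hy
  obtain rfl : y = x + 1 := by simpa [Code.eval] using hy
  simpa [he.succ] using (h _ List.mem_cons_self).rel_of_clause (by simp) e [x, x + 1]

theorem represents_left (he : Numerals I e) (h : ∀ r ∈ definingRules .left, I.SatRule r) :
    Represents I e .left := by
  intro x y hy
  obtain rfl : x.unpair.1 = y := by simpa [Code.eval, eq_comm] using hy
  have hx := he.pair x.unpair.1 x.unpair.2
  rw [Nat.pair_unpair] at hx
  simpa [hx] using
    (h _ List.mem_cons_self).rel_of_clause (by simp) e [x.unpair.1, x.unpair.2, x]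

theorem represents_right (he : Numerals I e) (h : ∀ r ∈ definingRules .right, I.SatRule r) :
    Represents I e .right := by
  intro x y hy
  obtain rfl : x.unpair.2 = y := by simpa [Code.eval, eq_comm] using hy
  have hx := he.pair x.unpair.1 x.unpair.2
  rw [Nat.pair_unpair] at hx
  simpa [hx] using
    (h _ List.mem_cons_self).rel_of_clause (by simp) e [x.unpair.1, x.unpair.2, x]

theorem represents_pair (he : Numerals I e)
    (h : ∀ r ∈ definingRules (.pair f g), I.SatRule r) (hf : Represents I e f)
    (hg : Represents I e g) : Represents I e (.pair f g) := by
  intro x y hy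
  obtain ⟨a, ha, b, hb, rfl⟩ := mem_eval_pair.1 hy
  simpa [hf x a ha, hg x b hb, he.pair] using
    (h _ List.mem_cons_self).rel_of_clause (by simp) e [x, a, b, Nat.pair a b]

theorem represents_prec (he : Numerals I e)
    (h : ∀ r ∈ definingRules (.prec f g), I.SatRule r) (hf : Represents I e f)
    (hg : Represents I e g) : Represents I e (.prec f g) := by
  simp only [definingRules, List.forall_mem_cons] at h
  obtain ⟨prec_zero, prec_succ, -⟩ := h
  intro x y hy
  obtain ⟨a, n, rfl⟩ : ∃ a n, x = Nat.pair a n := ⟨_, _, (Nat.pair_unpair x).symm⟩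
  induction n generalizing y with
  | zero =>
    rw [Code.eval_prec_zero] at hy
    simpa [he.zero, he.pair, hf a y hy] using
      prec_zero.rel_of_clause (by simp) e [0, a, Nat.pair a 0, y]
  | succ n ih =>
    obtain ⟨i, hi, hy⟩ := mem_eval_prec_succ.1 hy
    simpa [he.succ, he.pair, ih i hi, hg _ y hy] using
      prec_succ.rel_of_clause (by simp) e [a, n, Nat.pair a n, i, Nat.pair n i,
        Nat.pair a (Nat.pair n i), y, n + 1, Nat.pair a (n + 1)]

theorem represents_rfind' (he : Numerals I e)
    (h : ∀ r ∈ definingRules (.rfind' f), I.SatRule r) (hf : Represents I e f) :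
    Represents I e (.rfind' f) := by
  simp only [definingRules, List.forall_mem_cons] at h
  obtain ⟨rfind_found, rfind_next, -⟩ := h
  intro x y hy
  obtain ⟨a, m, rfl⟩ : ∃ a m, x = Nat.pair a m := ⟨_, _, (Nat.pair_unpair x).symm⟩
  obtain ⟨d, rfl⟩ := Nat.exists_eq_add_of_le (le_of_mem_eval_rfind' hy)
  induction d generalizing m with
  | zero =>
    rcases mem_eval_rfind'_iff.1 hy with ⟨-, h0⟩ | ⟨-, hy⟩
    · simpa [he.zero, he.pair, hf _ 0 h0] using
        rfind_found.rel_of_clause (by simp) e [a, m, Nat.pair a m, 0]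
    · exact absurd (le_of_mem_eval_rfind' hy) (by omega)
  | succ d ih =>
    rcases mem_eval_rfind'_iff.1 hy with ⟨hm, -⟩ | ⟨⟨z, hz⟩, hy⟩
    · omega
    rw [← add_assoc, add_right_comm] at hy ⊢
    simpa [he.succ, he.pair, hf _ _ hz, ih (m + 1) hy] using
      rfind_next.rel_of_clause (by simp) e [a, m, Nat.pair a m, z + 1, z, m + 1,
        Nat.pair a (m + 1), m + 1 + d]

theorem represents {c : Code} (he : Numerals I e)
    (h : ∀ d ∈ subcodes c, ∀ r ∈ definingRules d, I.SatRule r) : Represents I e c := by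
  induction c with
  | zero => exact he.represents_zero (h _ List.mem_cons_self)
  | succ => exact he.represents_succ (h _ List.mem_cons_self)
  | left => exact he.represents_left (h _ List.mem_cons_self)
  | right => exact he.represents_right (h _ List.mem_cons_self)
  | pair f g hf hg =>
    simp only [subcodes, List.forall_mem_cons, List.forall_mem_append] at h
    exact he.represents_pair h.1 (hf h.2.1) (hg h.2.2)
  | comp f g hf hg =>
    simp only [subcodes, List.forall_mem_cons, List.forall_mem_append] at h
    exact represents_comp h.1 (hf h.2.1) (hg h.2.2)
  | prec f g hf hg =>
    simp only [subcodes, List.forall_mem_cons, List.forall_mem_append] at h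
    exact he.represents_prec h.1 (hf h.2.1) (hg h.2.2)
  | rfind' f hf =>
    simp only [subcodes, List.forall_mem_cons] at h
    exact he.represents_rfind' h.1 (hf h.2)

end Numerals

theorem Interp.IsModel.exists_numerals {n : ℕ} {c : Code}
    (h : I.IsModel (numeralFacts n, programRules c)) :
    ∃ e : ℕ → D, e n = I.const 1 ∧ Numerals I e := by
  obtain ⟨hF, hR⟩ := h
  simp only [KB.facts, KB.rules, numeralFacts, programRules, List.forall_mem_cons,
    List.forall_mem_append, List.forall_mem_map, List.mem_range] at hF hR
  obtain ⟨hsucc, harith, -⟩ := hR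
  obtain ⟨e, hec, hes⟩ := exists_seq_extending (r := fun x y => I.rel succ [x, y])
    (fun _ _ => hsucc.rel_succ) (fun i => I.const (n + 1 - i)) (n := n) fun i hi => by
      rw [Nat.sub_add_comm hi, Nat.add_sub_add_right]
      exact hF.2 (n - i) (by omega)
  exact ⟨e, (hec n n.le_succ).trans (congrArg I.const (by omega)),
    numerals_of_arithRules harith (hec 0 (Nat.zero_le _) ▸ hF.1) hes⟩

end

theorem entails_programRules_iff (c : Code) (n : ℕ) :
    Entails (numeralFacts n, programRules c) (haltQuery c) ↔ (c.eval n).Dom := by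
  rw [Part.dom_iff_mem]
  constructor
  · intro h
    obtain ⟨v, hv⟩ := h ℕ (standardInterp n) standardInterp_isModel
    have hv : v 0 ∈ c.eval (n + 1 - 1) := (standardInterp_rel (graph c)).1 hv
    exact ⟨v 0, hv⟩
  · rintro ⟨y, hy⟩ D I hI
    obtain ⟨e, hn, he⟩ := hI.exists_numerals
    have hc : Represents I e c := he.represents fun d hd r hr => hI.2 r (by
      simp only [programRules, KB.rules, List.mem_cons, List.mem_append, List.mem_flatMap]
      exact .inr (.inr ⟨d, hd, hr⟩))
    have hny := hc n y hy
    rw [hn] at hny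
    exact ⟨fun _ => e y, hny⟩

/-! ### The reduction from the halting problem -/

theorem exists_universal_code :
    ∃ u : Code, ∀ c : Code, (u.eval (Encodable.encode c)).Dom ↔ (c.eval 0).Dom := by
  obtain ⟨u, hu⟩ := Code.exists_code.1 <|
    show Partrec fun c : Code => c.eval 0 from
      Code.eval_part.comp Computable.id (Computable.const 0)
  exact ⟨u, fun c => by simp [hu]⟩

theorem exists_not_computablePred_eval_dom :
    ∃ u : Code, ¬ ComputablePred fun n => (u.eval n).Dom := by
  obtain ⟨u, hu⟩ := exists_universal_code
  exact ⟨u, fun h => ComputablePred.halting_problem 0 <|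
    .computable_of_manyOneReducible
      ⟨Encodable.encode, Computable.encode, fun c => (hu c).symm⟩ h⟩

theorem primrec_numeralFacts : Primrec numeralFacts := by
  refine Primrec.list_cons.comp ((Primrec.const _).pair ?_)
    (Primrec.list_map (Primrec.list_range.comp Primrec.succ) ?_)
  · exact Primrec.list_cons.comp Primrec.succ (Primrec.const [])
  · exact (Primrec.const _).pair (Primrec.list_cons.comp (Primrec.succ.comp Primrec.snd)
      (Primrec.list_cons.comp Primrec.snd (Primrec.const [])))

theorem primrec_toBase {α : Type} [Primcodable α] : Primrec (toBase : ℕ × α → ℕ × α) :=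
  (Primrec.nat_mul.comp (Primrec.const 2) Primrec.fst).pair Primrec.snd

theorem DecidableOn.computablePred {α β : Type} [Primcodable α] [Primcodable β] {C P : α → Prop}
    (h : DecidableOn C P) {g : β → α} (hg : Computable g) (hC : ∀ b, C (g b)) :
    ComputablePred fun b => P (g b) := by
  classical
  obtain ⟨f, hf, hfC⟩ := h
  refine ⟨fun _ => Classical.dec _, (hf.comp hg).of_eq fun b => ?_⟩
  obtain ⟨t, ht, htP⟩ := hfC (g b) (hC b)
  rw [Part.eq_some_iff.2 ht]
  congr 1
  rw [Bool.eq_iff_iff, htP, decide_eq_true_iff]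

theorem DecidableOn.computablePred_entails {C : KB → Prop} {R : List (Rule ℕ)} {q : Atom ℕ}
    (h : DecidableOn (fun i : KB × Atom ℕ => C i.1) fun i => Entails i.1 i.2)
    (hC : ∀ F, C (F, R)) : ComputablePred fun F : List Fact => Entails (F, R) q :=
  h.computablePred (g := fun F => ((F, R), q))
    ((Primrec.id.pair (.const R)).pair (.const q)).to_comp hC

end ExRules

theorem theorem1_general : ∃ (R : List (ExRules.Rule ℕ)) (q : ExRules.Atom ℕ),
    (∀ F, ExRules.IsAGRDSingleTrans (F, R)) ∧
      ¬ ComputablePred fun F : List ExRules.Fact => ExRules.Entails (F, R) q := by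
  obtain ⟨u, hu⟩ := ExRules.exists_not_computablePred_eval_dom
  refine ⟨ExRules.splitRules (ExRules.programRules u), ExRules.toBase (ExRules.haltQuery u),
    fun F => ExRules.isAGRDSingleTrans_splitRules F fun _ => ExRules.proper_of_mem_programRules,
    fun h => hu ?_⟩
  refine .computable_of_manyOneReducible
    ⟨fun n => (ExRules.numeralFacts n).map ExRules.toBase, ?_, fun n => ?_⟩ h
  · exact (Primrec.list_map ExRules.primrec_numeralFacts
      (ExRules.primrec_toBase.comp₂ Primrec₂.right)).to_comp
  · exact (ExRules.entails_splitRules.trans (ExRules.entails_programRules_iff u n)).symm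

theorem theorem1 :
    (¬ ExRules.DecidableOn (fun i : ExRules.KB × ExRules.Atom ℕ => ExRules.IsAGRDTrans i.1)
        (fun i => ExRules.Entails i.1 i.2)) ∧
    (¬ ExRules.DecidableOn (fun i : ExRules.KB × ExRules.Atom ℕ => ExRules.IsAGRDSingleTrans i.1)
        (fun i => ExRules.Entails i.1 i.2)) :=
  let ⟨_, _, hR, hq⟩ := theorem1_general
  ⟨fun h => hq (h.computablePred_entails fun F => (hR F).isAGRDTrans),
    fun h => hq (h.computablePred_entails hR)⟩
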